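/- Let $L_2(\mathbb R_+)$ be the space of (real- or complex-valued) functions that are square-integrable on $(0,\infty)$ with respect to Lebesgue measure, functions equal almost everywhere being identified. Let $g\in L_2(\mathbb R_+)$ be a given function. The integral equation of the second kind with the Stieltjes kernel $$f(x)+\frac1\pi\int_0^\infty\frac{f(t)}{x+t}\,dt=g(x),\qquad x>0,\tag{A}$$ has a unique solution $f\in L_2(\mathbb R_+)$, and it is given by $$f(x)=g(x)-\frac{2}{\pi^2}\int_0^\infty\frac{\sqrt{xt}\,(\log x-\log t)}{x^2-t^2}\,g(t)\,dt,\qquad x>0.\tag{B}$$ Conversely, for a given $f\in L_2(\mathbb R_+)$, the integral equation (B) has a unique solution $g\in L_2(\mathbb R_+)$, and it is given by formula (A). For all $f,g\in L_2(\mathbb R_+)$ the integrals in (A) and (B) converge absolutely for every $x>0$. -/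

import Mathlib

open MeasureTheory Set

noncomputable section

/-- Lebesgue measure on the half-line `(0, ∞)`. -/
def halfLine : Measure ℝ := volume.restrict (Ioi (0 : ℝ))

/-- The Stieltjes kernel `1 / (x + t)`. -/
def stieltjesKernel (x t : ℝ) : ℝ := 1 / (x + t)

/-- The kernel `√(x t) (log x - log t) / (x² - t²)`.
For `x > 0` its value on the null set `t = x` is irrelevant. -/
def logKernel (x t : ℝ) : ℝ :=
  Real.sqrt (x * t) * (Real.log x - Real.log t) / (x ^ 2 - t ^ 2)

/-- `f(x) + (1/π) ∫₀^∞ f(t) / (x + t) dt`. -/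
def stieltjesSide {𝕜 : Type*} [RCLike 𝕜] (f : ℝ → 𝕜) (x : ℝ) : 𝕜 :=
  f x + (1 / Real.pi) • ∫ t, stieltjesKernel x t • f t ∂halfLine

/-- `g(x) - (2/π²) ∫₀^∞ √(x t) (log x - log t) / (x² - t²) g(t) dt`. -/
def logSide {𝕜 : Type*} [RCLike 𝕜] (g : ℝ → 𝕜) (x : ℝ) : 𝕜 :=
  g x - (2 / Real.pi ^ 2) • ∫ t, logKernel x t • g t ∂halfLine

end

/-!
Write `S` and `L` for the Stieltjes and the logarithmic kernel, and put
`P(x, t) = √(x t) / (x² + t²)` and `Q(x, t) = (x + t) / (x² + t²)`. Partial fractions show that,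
under composition of kernels on the half-line,
`P P = L`, `S P = P S = (π/√2) Q - π P` and `Q P = (π/√2) S`,
so that `S L = L S = (S P) P = (π²/2) S - π L`. This relation is equivalent to `I + S/π` and
`I - (2/π²) L` being inverse to each other. The kernel `P` is found by passing to the variable
`log x`, where these are convolution operators: with `c = cosh (π ξ / 2)` the symbols of `S` and
`L` are `π / (2 c² - 1)` and `(π / (2 c))²`, and `P` is the square root of `L`.

All four kernels are dominated by multiples of `S`, which acts on `L^p` for `1 < p < ∞` by
Hilbert's inequality, that is by Schur's test with the weight `t ^ (-1 / (p q))`.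
-/

section HalfLineIntegrals

open Real

theorem lintegral_rpow_mul_exp_neg_mul_Ioi {a r : ℝ} (ha : 0 < a) (hr : 0 < r) :
    ∫⁻ t in Ioi 0, ENNReal.ofReal (t ^ (a - 1) * exp (-(r * t))) =
      ENNReal.ofReal ((1 / r) ^ a * Gamma a) := by
  have hpos : 0 < (1 / r) ^ a * Gamma a := by have := Gamma_pos_of_pos ha; positivity
  rw [← integral_rpow_mul_exp_neg_mul_Ioi ha hr] at hpos ⊢
  refine (ofReal_integral_eq_lintegral_ofReal (Integrable.of_integral_ne_zero hpos.ne') ?_).symm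
  filter_upwards [ae_restrict_mem measurableSet_Ioi] with t ht
  exact mul_nonneg (rpow_nonneg (le_of_lt ht) _) (exp_pos _).le

theorem lintegral_exp_neg_mul_Ioi {r : ℝ} (hr : 0 < r) :
    ∫⁻ s in Ioi 0, ENNReal.ofReal (exp (-(r * s))) = ENNReal.ofReal (1 / r) := by
  simpa using lintegral_rpow_mul_exp_neg_mul_Ioi one_pos hr

theorem lintegral_rpow_div_add_Ioi {a b : ℝ} (ha₀ : 0 < a) (ha₁ : a < 1) (hb : 0 < b) :
    ∫⁻ y in Ioi 0, ENNReal.ofReal (y ^ (a - 1) / (y + b)) =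
      ENNReal.ofReal (π / sin (π * a) * b ^ (a - 1)) := by
  have hm : AEMeasurable (Function.uncurry fun y s : ℝ =>
      ENNReal.ofReal (y ^ (a - 1) * exp (-((y + b) * s))))
      ((volume.restrict (Ioi 0)).prod (volume.restrict (Ioi 0))) := by fun_prop
  calc ∫⁻ y in Ioi 0, ENNReal.ofReal (y ^ (a - 1) / (y + b))
      = ∫⁻ y in Ioi 0, ∫⁻ s in Ioi 0,
          ENNReal.ofReal (y ^ (a - 1) * exp (-((y + b) * s))) := by
        refine setLIntegral_congr_fun measurableSet_Ioi fun y (hy : 0 < y) => ?_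
        have hy' : 0 ≤ y ^ (a - 1) := rpow_nonneg hy.le _
        simp_rw [ENNReal.ofReal_mul hy']
        rw [lintegral_const_mul _ (by fun_prop), lintegral_exp_neg_mul_Ioi (by positivity),
          ← ENNReal.ofReal_mul hy', mul_one_div]
    _ = ∫⁻ s in Ioi 0, ∫⁻ y in Ioi 0,
          ENNReal.ofReal (y ^ (a - 1) * exp (-((y + b) * s))) := lintegral_lintegral_swap hm
    _ = ∫⁻ s in Ioi 0, ENNReal.ofReal (Gamma a) *
          ENNReal.ofReal (s ^ ((1 - a) - 1) * exp (-(b * s))) := by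
        refine setLIntegral_congr_fun measurableSet_Ioi fun s (hs : 0 < s) => ?_
        have hsplit : ∀ y : ℝ, y ^ (a - 1) * exp (-((y + b) * s)) =
            exp (-(b * s)) * (y ^ (a - 1) * exp (-(s * y))) := fun y => by
          rw [mul_left_comm, ← exp_add]; ring_nf
        simp_rw [hsplit, ENNReal.ofReal_mul (exp_pos _).le]
        rw [lintegral_const_mul _ (by fun_prop), lintegral_rpow_mul_exp_neg_mul_Ioi ha₀ hs,
          ← ENNReal.ofReal_mul (exp_pos _).le,
          ← ENNReal.ofReal_mul (Gamma_pos_of_pos ha₀).le, one_div, inv_rpow hs.le,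
          ← rpow_neg hs.le, show (1 - a) - 1 = -a by ring]
        ring_nf
    _ = ENNReal.ofReal (π / sin (π * a) * b ^ (a - 1)) := by
        rw [lintegral_const_mul _ (by fun_prop),
          lintegral_rpow_mul_exp_neg_mul_Ioi (sub_pos.2 ha₁) hb,
          ← ENNReal.ofReal_mul (Gamma_pos_of_pos ha₀).le, ← Gamma_mul_Gamma_one_sub, one_div,
          inv_rpow hb.le, ← rpow_neg hb.le, neg_sub]
        ring_nf

theorem integral_rpow_div_add_Ioi {a b : ℝ} (ha₀ : 0 < a) (ha₁ : a < 1) (hb : 0 < b) :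
    ∫ y in Ioi 0, y ^ (a - 1) / (y + b) = π / sin (π * a) * b ^ (a - 1) := by
  have hsin : 0 < sin (π * a) := sin_pos_of_pos_of_lt_pi (by positivity) (by nlinarith [pi_pos])
  rw [integral_eq_lintegral_of_nonneg_ae _ (by fun_prop : Measurable _).aestronglyMeasurable,
    lintegral_rpow_div_add_Ioi ha₀ ha₁ hb,
    ENNReal.toReal_ofReal (by positivity)]
  filter_upwards [ae_restrict_mem measurableSet_Ioi] with y hy
  have hy : 0 < y := hy
  simp only [Pi.zero_apply]
  positivity

theorem integral_rpow_div_rpow_add_rpow_Ioi {a b c : ℝ} (ha : 0 < a) (hac : a < c) (hb : 0 < b) :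
    ∫ y in Ioi 0, y ^ (a - 1) / (y ^ c + b ^ c) = π / (c * sin (π * (a / c))) * b ^ (a - c) := by
  have hc : 0 < c := ha.trans hac
  have h := integral_comp_rpow_Ioi_of_pos (g := fun v => v ^ (a / c - 1) / (v + b ^ c)) hc
  rw [integral_rpow_div_add_Ioi (by positivity) ((div_lt_one hc).2 hac) (by positivity),
    ← rpow_mul hb.le, mul_sub, mul_div_cancel₀ _ hc.ne', mul_one] at h
  have hcongr : EqOn (fun y : ℝ => (c * y ^ (c - 1)) • ((y ^ c) ^ (a / c - 1) / (y ^ c + b ^ c)))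
      (fun y => c * (y ^ (a - 1) / (y ^ c + b ^ c))) (Ioi 0) := fun y (hy : 0 < y) => by
    simp only [smul_eq_mul]
    rw [← rpow_mul hy.le, mul_assoc, ← mul_div_assoc, ← rpow_add hy, mul_sub,
      mul_div_cancel₀ _ hc.ne']
    ring_nf
  rw [setIntegral_congr_fun measurableSet_Ioi hcongr, integral_const_mul] at h
  rw [eq_div_of_mul_eq hc.ne' ((mul_comm _ _).trans h)]
  ring

theorem integral_inv_sqrt_mul_add_Ioi {b : ℝ} (hb : 0 < b) :
    ∫ y in Ioi 0, (√y * (y + b))⁻¹ = π / √b := by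
  have h := integral_rpow_div_add_Ioi (a := 1 / 2) (by norm_num) (by norm_num) hb
  rw [show π * (1 / 2) = π / 2 by ring, sin_pi_div_two, div_one,
    show (1 / 2 - 1 : ℝ) = -(1 / 2) by norm_num, rpow_neg hb.le, ← sqrt_eq_rpow] at h
  rw [div_eq_mul_inv, ← h]
  refine setIntegral_congr_fun measurableSet_Ioi fun y (hy : 0 < y) => ?_
  rw [rpow_neg hy.le, ← sqrt_eq_rpow, mul_inv, div_eq_mul_inv]

theorem integral_sqrt_div_sq_add_sq_Ioi {b : ℝ} (hb : 0 < b) :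
    ∫ y in Ioi 0, √y / (y ^ 2 + b ^ 2) = π / √2 / √b := by
  have h := integral_rpow_div_rpow_add_rpow_Ioi (a := 3 / 2) (c := 2) (by norm_num) (by norm_num) hb
  rw [show π * (3 / 2 / 2) = π - π / 4 by ring, sin_pi_sub, sin_pi_div_four,
    show (3 / 2 - 2 : ℝ) = -(1 / 2) by norm_num, rpow_neg hb.le] at h
  norm_num [← sqrt_eq_rpow] at h
  rw [h]
  field_simp

theorem integral_inv_sqrt_mul_sq_add_sq_Ioi {b : ℝ} (hb : 0 < b) :
    ∫ y in Ioi 0, (√y * (y ^ 2 + b ^ 2))⁻¹ = π / √2 / (b * √b) := by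
  have h := integral_rpow_div_rpow_add_rpow_Ioi (a := 1 / 2) (c := 2) (by norm_num) (by norm_num) hb
  rw [show π * (1 / 2 / 2) = π / 4 by ring, sin_pi_div_four,
    show (1 / 2 - 1 : ℝ) = -(1 / 2) by norm_num,
    show (1 / 2 - 2 : ℝ) = -(1 + 1 / 2) by norm_num, rpow_neg hb.le, rpow_add hb, rpow_one,
    ← sqrt_eq_rpow] at h
  simp only [rpow_two] at h
  calc ∫ y in Ioi 0, (√y * (y ^ 2 + b ^ 2))⁻¹
      = ∫ y in Ioi 0, y ^ (-(1 / 2 : ℝ)) / (y ^ 2 + b ^ 2) := by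
        refine setIntegral_congr_fun measurableSet_Ioi fun y (hy : 0 < y) => ?_
        rw [rpow_neg hy.le, ← sqrt_eq_rpow, mul_inv, div_eq_mul_inv]
    _ = π / √2 / (b * √b) := by rw [h]; field_simp

theorem integrableOn_inv_sqrt_mul_add {b : ℝ} (hb : 0 < b) :
    IntegrableOn (fun y => (√y * (y + b))⁻¹) (Ioi 0) :=
  .of_integral_ne_zero (by rw [integral_inv_sqrt_mul_add_Ioi hb]; positivity)

theorem integrableOn_sqrt_div_sq_add_sq {b : ℝ} (hb : 0 < b) :
    IntegrableOn (fun y => √y / (y ^ 2 + b ^ 2)) (Ioi 0) :=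
  .of_integral_ne_zero (by rw [integral_sqrt_div_sq_add_sq_Ioi hb]; positivity)

theorem integrableOn_inv_sqrt_mul_sq_add_sq {b : ℝ} (hb : 0 < b) :
    IntegrableOn (fun y => (√y * (y ^ 2 + b ^ 2))⁻¹) (Ioi 0) :=
  .of_integral_ne_zero (by rw [integral_inv_sqrt_mul_sq_add_sq_Ioi hb]; positivity)

open Filter Topology in
theorem integral_div_sq_add_sq_mul_sq_add_sq_Ioi {x t : ℝ} (hx : 0 < x) (ht : 0 < t) (hxt : x ≠ t) :
    ∫ y in Ioi 0, y / ((y ^ 2 + x ^ 2) * (y ^ 2 + t ^ 2)) =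
      (log x - log t) / (x ^ 2 - t ^ 2) := by
  have hxt' : x ^ 2 - t ^ 2 ≠ 0 := sub_ne_zero.2 fun h => hxt ((sq_eq_sq₀ hx.le ht.le).1 h)
  set F : ℝ → ℝ := fun y => (log (y ^ 2 + t ^ 2) - log (y ^ 2 + x ^ 2)) / (2 * (x ^ 2 - t ^ 2))
  have hlog : ∀ y {c : ℝ}, 0 < c →
      HasDerivAt (fun y => log (y ^ 2 + c ^ 2)) (2 * y / (y ^ 2 + c ^ 2)) y := fun y c hc => by
    simpa using ((hasDerivAt_pow 2 y).add_const (c ^ 2)).log (by positivity)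
  have hderiv : ∀ y, HasDerivAt F (y / ((y ^ 2 + x ^ 2) * (y ^ 2 + t ^ 2))) y := fun y => by
    refine (((hlog y ht).sub (hlog y hx)).div_const _).congr_deriv ?_
    field_simp
    ring
  have hlim : Tendsto F atTop (𝓝 0) := by
    have hsq : Tendsto (fun y : ℝ => y ^ 2) atTop atTop := tendsto_pow_atTop two_ne_zero
    have h := ((tendsto_log_comp_add_sub_log (t ^ 2)).comp hsq).sub
      ((tendsto_log_comp_add_sub_log (x ^ 2)).comp hsq)
    simpa [F] using h.div_const (2 * (x ^ 2 - t ^ 2))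
  rw [integral_Ioi_of_hasDerivAt_of_nonneg' (fun y _ => hderiv y)
    (fun y (hy : 0 < y) => by positivity) hlim]
  simp only [F, zero_pow two_ne_zero, zero_add, log_pow]
  field_simp
  ring

end HalfLineIntegrals

section SchurTest

open scoped ENNReal

variable {α β : Type*} [MeasurableSpace α] [MeasurableSpace β] {μ : Measure α} {ν : Measure β}
  {p q : ℝ}

theorem rpow_lintegral_mul_le_of_weight (hpq : p.HolderConjugate q) {κ v u : β → ℝ≥0∞}
    (hκ : AEMeasurable κ ν) (hv : AEMeasurable v ν) (hv₀ : ∀ᵐ t ∂ν, v t ≠ 0 ∧ v t ≠ ∞)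
    (hu : AEMeasurable u ν) :
    (∫⁻ t, κ t * u t ∂ν) ^ p ≤
      (∫⁻ t, κ t * v t ^ q ∂ν) ^ (p - 1) * ∫⁻ t, κ t * (u t / v t) ^ p ∂ν := by
  have hdensity : ∀ {f : β → ℝ≥0∞}, AEMeasurable f ν →
      ∫⁻ t, f t ∂(ν.withDensity κ) = ∫⁻ t, κ t * f t ∂ν :=
    lintegral_withDensity_eq_lintegral_mul₀ hκ
  have hac := withDensity_absolutelyContinuous ν κ
  have hr : AEMeasurable (fun t => u t / v t) ν := hu.div hv
  calc (∫⁻ t, κ t * u t ∂ν) ^ p = (∫⁻ t, v t * (u t / v t) ∂(ν.withDensity κ)) ^ p := by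
        rw [hdensity (hv.fun_mul hr)]
        congr 1
        refine lintegral_congr_ae (hv₀.mono fun t ht => ?_)
        simp only [ENNReal.mul_div_cancel ht.1 ht.2]
    _ ≤ ((∫⁻ t, v t ^ q ∂(ν.withDensity κ)) ^ (1 / q) *
          (∫⁻ t, (u t / v t) ^ p ∂(ν.withDensity κ)) ^ (1 / p)) ^ p :=
        ENNReal.rpow_le_rpow (ENNReal.lintegral_mul_le_Lp_mul_Lq (ν.withDensity κ) hpq.symm
          (hv.mono_ac hac) (hr.mono_ac hac)) hpq.nonneg
    _ = (∫⁻ t, κ t * v t ^ q ∂ν) ^ (p - 1) * ∫⁻ t, κ t * (u t / v t) ^ p ∂ν := by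
        rw [hdensity (hv.pow_const q), hdensity (hr.pow_const p),
          ENNReal.mul_rpow_of_nonneg _ _ hpq.nonneg, ← ENNReal.rpow_mul, ← ENNReal.rpow_mul,
          one_div_mul_cancel hpq.ne_zero, ENNReal.rpow_one, one_div_mul_eq_div,
          hpq.div_conj_eq_sub_one]

theorem lintegral_rpow_lintegral_mul_le_of_schur [SFinite μ] [SFinite ν]
    (hpq : p.HolderConjugate q) {k : α → β → ℝ≥0∞} (hk : Measurable (Function.uncurry k))
    {v : β → ℝ≥0∞} (hv : AEMeasurable v ν) (hv₀ : ∀ᵐ t ∂ν, v t ≠ 0 ∧ v t ≠ ∞)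
    {w : α → ℝ≥0∞} (hw : AEMeasurable w μ) {A B : ℝ≥0∞}
    (hA : ∀ᵐ x ∂μ, ∫⁻ t, k x t * v t ^ q ∂ν ≤ A * w x ^ q)
    (hB : ∀ᵐ t ∂ν, ∫⁻ x, k x t * w x ^ p ∂μ ≤ B * v t ^ p)
    {u : β → ℝ≥0∞} (hu : AEMeasurable u ν) :
    ∫⁻ x, (∫⁻ t, k x t * u t ∂ν) ^ p ∂μ ≤ A ^ (p - 1) * B * ∫⁻ t, u t ^ p ∂ν := by
  have hp := hpq.sub_one_pos
  have hr : AEMeasurable (fun t => (u t / v t) ^ p) ν := (hu.div hv).pow_const p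
  have hmeas : AEMeasurable
      (Function.uncurry fun x t => A ^ (p - 1) * (k x t * w x ^ p) * (u t / v t) ^ p)
      (μ.prod ν) := ((hk.aemeasurable.mul (hw.pow_const p).comp_fst).const_mul _).mul hr.comp_snd
  calc ∫⁻ x, (∫⁻ t, k x t * u t ∂ν) ^ p ∂μ
      ≤ ∫⁻ x, ∫⁻ t, A ^ (p - 1) * (k x t * w x ^ p) * (u t / v t) ^ p ∂ν ∂μ := by
        refine lintegral_mono_ae (hA.mono fun x hx => ?_)
        have hkx : AEMeasurable (k x) ν := hk.of_uncurry_left.aemeasurable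
        calc (∫⁻ t, k x t * u t ∂ν) ^ p
            ≤ (∫⁻ t, k x t * v t ^ q ∂ν) ^ (p - 1) * ∫⁻ t, k x t * (u t / v t) ^ p ∂ν :=
              rpow_lintegral_mul_le_of_weight hpq hkx hv hv₀ hu
          _ ≤ (A * w x ^ q) ^ (p - 1) * ∫⁻ t, k x t * (u t / v t) ^ p ∂ν := by gcongr
          _ = ∫⁻ t, A ^ (p - 1) * (k x t * w x ^ p) * (u t / v t) ^ p ∂ν := by
              rw [ENNReal.mul_rpow_of_nonneg _ _ hp.le, ← ENNReal.rpow_mul, mul_comm q,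
                hpq.sub_one_mul_conj, ← lintegral_const_mul'' _ (hkx.fun_mul hr)]
              exact lintegral_congr fun t => by ring
    _ = ∫⁻ t, ∫⁻ x, A ^ (p - 1) * (k x t * w x ^ p) * (u t / v t) ^ p ∂μ ∂ν :=
        lintegral_lintegral_swap hmeas
    _ ≤ ∫⁻ t, A ^ (p - 1) * B * u t ^ p ∂ν := by
        refine lintegral_mono_ae ?_
        filter_upwards [hB, hv₀] with t ht ⟨hvt₀, hvt⟩
        have hkt : AEMeasurable (fun x => k x t * w x ^ p) μ :=
          hk.of_uncurry_right.aemeasurable.mul (hw.pow_const p)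
        rw [lintegral_mul_const'' _ (hkt.const_mul _), lintegral_const_mul'' _ hkt]
        calc A ^ (p - 1) * (∫⁻ x, k x t * w x ^ p ∂μ) * (u t / v t) ^ p
            ≤ A ^ (p - 1) * (B * v t ^ p) * (u t / v t) ^ p := by gcongr
          _ = A ^ (p - 1) * B * u t ^ p := by
              rw [mul_assoc, mul_assoc B, ← ENNReal.mul_rpow_of_nonneg _ _ hpq.nonneg,
                ENNReal.mul_div_cancel hvt₀ hvt, mul_assoc]
    _ = A ^ (p - 1) * B * ∫⁻ t, u t ^ p ∂ν := lintegral_const_mul'' _ (hu.pow_const p)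

end SchurTest

section HalfLine

open Real
open scoped ENNReal

instance : SFinite halfLine := by unfold halfLine; infer_instance

theorem ae_halfLine_pos : ∀ᵐ x ∂halfLine, 0 < x := ae_restrict_mem measurableSet_Ioi

theorem ae_halfLine_ne (x : ℝ) : ∀ᵐ t ∂halfLine, x ≠ t := by
  filter_upwards [ae_restrict_of_ae (Measure.ae_ne volume x)] with t ht using ht.symm

theorem stieltjesKernel_pos {x t : ℝ} (hx : 0 < x) (ht : 0 < t) : 0 < stieltjesKernel x t := by
  unfold stieltjesKernel; positivity

theorem stieltjesKernel_comm (x t : ℝ) : stieltjesKernel x t = stieltjesKernel t x := by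
  rw [stieltjesKernel, stieltjesKernel, add_comm]

theorem measurable_stieltjesKernel : Measurable (Function.uncurry stieltjesKernel) := by
  unfold stieltjesKernel Function.uncurry; fun_prop

theorem lintegral_stieltjesKernel_mul_rpow {a x : ℝ} (ha₀ : 0 < a) (ha₁ : a < 1) (hx : 0 < x) :
    ∫⁻ t, ENNReal.ofReal (stieltjesKernel x t) * ENNReal.ofReal (t ^ (a - 1)) ∂halfLine =
      ENNReal.ofReal (π / sin (π * a)) * ENNReal.ofReal (x ^ (a - 1)) := by
  rw [← ENNReal.ofReal_mul' (by positivity), ← lintegral_rpow_div_add_Ioi ha₀ ha₁ hx]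
  refine setLIntegral_congr_fun measurableSet_Ioi fun t (ht : 0 < t) => ?_
  rw [← ENNReal.ofReal_mul (stieltjesKernel_pos hx ht).le, stieltjesKernel, one_div_mul_eq_div,
    add_comm x]

theorem lintegral_stieltjesKernel_mul_weight_rpow {p q x : ℝ} (hpq : p.HolderConjugate q)
    (hx : 0 < x) :
    ∫⁻ t, ENNReal.ofReal (stieltjesKernel x t) *
        ENNReal.ofReal (t ^ (-(p⁻¹ * q⁻¹))) ^ p ∂halfLine =
      ENNReal.ofReal (π / sin (π / p)) * ENNReal.ofReal (x ^ (-(p⁻¹ * q⁻¹))) ^ p := by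
  have hw : ∀ {t : ℝ}, 0 < t →
      ENNReal.ofReal (t ^ (-(p⁻¹ * q⁻¹))) ^ p = ENNReal.ofReal (t ^ (p⁻¹ - 1)) := fun ht => by
    rw [ENNReal.ofReal_rpow_of_pos (rpow_pos_of_pos ht _), ← rpow_mul ht.le, neg_mul,
      mul_right_comm, inv_mul_cancel₀ hpq.ne_zero, one_mul, hpq.inv_sub_one]
  rw [hw hx, div_eq_mul_inv π p,
    ← lintegral_stieltjesKernel_mul_rpow hpq.inv_pos (inv_lt_one_of_one_lt₀ hpq.lt) hx]
  exact setLIntegral_congr_fun measurableSet_Ioi fun t ht => by rw [hw ht]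

theorem lintegral_rpow_lintegral_stieltjesKernel_mul_le {p q : ℝ} (hpq : p.HolderConjugate q)
    {u : ℝ → ℝ≥0∞} (hu : AEMeasurable u halfLine) :
    ∫⁻ x, (∫⁻ t, ENNReal.ofReal (stieltjesKernel x t) * u t ∂halfLine) ^ p ∂halfLine ≤
      ENNReal.ofReal (π / sin (π / p)) ^ p * ∫⁻ t, u t ^ p ∂halfLine := by
  set A := ENNReal.ofReal (π / sin (π / p))
  set w : ℝ → ℝ≥0∞ := fun t => ENNReal.ofReal (t ^ (-(p⁻¹ * q⁻¹)))
  have hw : AEMeasurable w halfLine := by fun_prop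
  have hw₀ : ∀ᵐ t ∂halfLine, w t ≠ 0 ∧ w t ≠ ∞ := ae_halfLine_pos.mono fun t ht =>
    ⟨(ENNReal.ofReal_pos.2 (rpow_pos_of_pos ht _)).ne', ENNReal.ofReal_ne_top⟩
  have hsin : sin (π / q) = sin (π / p) := by
    rw [← sin_pi_sub, div_eq_mul_inv, div_eq_mul_inv, ← hpq.symm.one_sub_inv, mul_one_sub]
  have hrow : ∀ᵐ x ∂halfLine, ∫⁻ t, ENNReal.ofReal (stieltjesKernel x t) * w t ^ q ∂halfLine ≤
      A * w x ^ q := ae_halfLine_pos.mono fun x hx => by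
    simp only [A, w, mul_comm p⁻¹, ← hsin]
    exact (lintegral_stieltjesKernel_mul_weight_rpow hpq.symm hx).le
  have hcol : ∀ᵐ t ∂halfLine, ∫⁻ x, ENNReal.ofReal (stieltjesKernel x t) * w x ^ p ∂halfLine ≤
      A * w t ^ p := ae_halfLine_pos.mono fun t ht => by
    simp only [stieltjesKernel_comm _ t]
    exact (lintegral_stieltjesKernel_mul_weight_rpow hpq ht).le
  have hA : A ^ (p - 1) * A = A ^ p := by
    simpa using (ENNReal.rpow_add_of_nonneg (x := A) (p - 1) 1 hpq.sub_one_pos.le zero_le_one).symm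
  exact hA ▸ lintegral_rpow_lintegral_mul_le_of_schur hpq
    measurable_stieltjesKernel.ennreal_ofReal hw hw₀ hw hrow hcol hu

end HalfLine

section Operators

open scoped ENNReal

/-- The action `u ↦ ∫ k(·, t) u(t) dt` of a kernel `k` on `E`-valued functions on the half-line,
which are represented by functions on `ℝ`. -/
noncomputable def kernelOp {E : Type*} [NormedAddCommGroup E] [NormedSpace ℝ E] (k : ℝ → ℝ → ℝ)
    (u : ℝ → E) (x : ℝ) : E :=
  ∫ t, k x t • u t ∂halfLine

/-- The operator `I + c K` of an integral equation of the second kind, where `K` is the operator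
`kernelOp k`. -/
noncomputable def secondKindOp {E : Type*} [NormedAddCommGroup E] [NormedSpace ℝ E] (c : ℝ)
    (k : ℝ → ℝ → ℝ) (u : ℝ → E) (x : ℝ) : E :=
  u x + c • kernelOp k u x

/-- A measurable kernel dominated on the open quadrant by a multiple of the Stieltjes kernel.
By Hilbert's inequality such a kernel acts on every `L^p` with `1 < p < ∞`. -/
structure IsStieltjesBounded (k : ℝ → ℝ → ℝ) : Prop where
  measurable : Measurable (Function.uncurry k)
  exists_abs_le : ∃ C : ℝ, ∀ x t, 0 < x → 0 < t → |k x t| ≤ C * stieltjesKernel x t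

variable {E : Type*} [NormedAddCommGroup E] [NormedSpace ℝ E] {p : ℝ≥0∞} {u v : ℝ → E}
  {k l m : ℝ → ℝ → ℝ} {x : ℝ}

theorem kernelOp_congr_ae (h : u =ᵐ[halfLine] v) : kernelOp k u = kernelOp k v :=
  funext fun x => integral_congr_ae (h.mono fun t ht => by simp only [ht])

theorem secondKindOp_congr_ae (c : ℝ) (k : ℝ → ℝ → ℝ) (h : u =ᵐ[halfLine] v) :
    secondKindOp c k u =ᵐ[halfLine] secondKindOp c k v :=
  h.mono fun x hx => by rw [secondKindOp, secondKindOp, hx, kernelOp_congr_ae h]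

theorem memLp_stieltjesKernel (hp : 1 < p) (hp_top : p ≠ ∞) (hx : 0 < x) :
    MemLp (stieltjesKernel x) p halfLine := by
  have hp₀ : p ≠ 0 := (zero_lt_one.trans hp).ne'
  rw [← integrable_norm_rpow_iff
    measurable_stieltjesKernel.of_uncurry_left.aestronglyMeasurable hp₀ hp_top]
  have hp' : 1 < p.toReal :=
    ENNReal.toReal_one ▸ (ENNReal.toReal_lt_toReal ENNReal.one_ne_top hp_top).2 hp
  refine IntegrableOn.congr_fun (f := fun t => (t + x) ^ (-p.toReal))
    (integrableOn_add_rpow_Ioi_of_lt (neg_lt_neg hp') (neg_lt_zero.2 hx)) (fun t (ht : 0 < t) => ?_)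
    measurableSet_Ioi
  rw [Real.norm_of_nonneg (stieltjesKernel_pos hx ht).le, stieltjesKernel, one_div,
    Real.inv_rpow (by positivity), ← Real.rpow_neg (by positivity), add_comm]

namespace IsStieltjesBounded

theorem abs (hk : IsStieltjesBounded k) : IsStieltjesBounded fun x t => |k x t| :=
  ⟨hk.measurable.abs, by simpa only [abs_abs] using hk.exists_abs_le⟩

theorem memLp (hk : IsStieltjesBounded k) (hp : 1 < p) (hp_top : p ≠ ∞) (hx : 0 < x) :
    MemLp (k x) p halfLine := by
  obtain ⟨C, hC⟩ := hk.exists_abs_le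
  refine (memLp_stieltjesKernel hp hp_top hx).of_le_mul (c := C)
    hk.measurable.of_uncurry_left.aestronglyMeasurable ?_
  filter_upwards [ae_halfLine_pos] with t ht
  rw [Real.norm_eq_abs, Real.norm_of_nonneg (stieltjesKernel_pos hx ht).le]
  exact hC x t hx ht

theorem integrable (hk : IsStieltjesBounded k) (hp : 1 < p) (hp_top : p ≠ ∞)
    (hu : MemLp u p halfLine) (hx : 0 < x) : Integrable (fun t => k x t • u t) halfLine := by
  have hpq := ENNReal.HolderConjugate.conjExponent hp.le
  have hq : 1 < p.conjExponent :=
    (ENNReal.HolderConjugate.lt_top_iff_one_lt p p.conjExponent).1 hp_top.lt_top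
  have hq_top : p.conjExponent ≠ ∞ :=
    ((ENNReal.HolderConjugate.lt_top_iff_one_lt p.conjExponent p).2 hp).ne
  exact memLp_one_iff_integrable.1 (hu.smul (r := 1) (hk.memLp hq hq_top hx))

theorem aestronglyMeasurable (hk : IsStieltjesBounded k) (hu : AEStronglyMeasurable u halfLine) :
    AEStronglyMeasurable (Function.uncurry fun x t => k x t • u t) (halfLine.prod halfLine) :=
  AEStronglyMeasurable.smul hk.measurable.aestronglyMeasurable hu.comp_snd

theorem exists_enorm_kernelOp_le (hk : IsStieltjesBounded k) (u : ℝ → E) : ∃ C : ℝ, ∀ x, 0 < x →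
    ‖kernelOp k u x‖ₑ ≤
      ENNReal.ofReal C * ∫⁻ t, ENNReal.ofReal (stieltjesKernel x t) * ‖u t‖ₑ ∂halfLine := by
  obtain ⟨C, hC⟩ := hk.exists_abs_le
  refine ⟨C, fun x hx => ?_⟩
  rw [← lintegral_const_mul' _ _ ENNReal.ofReal_ne_top]
  refine (enorm_integral_le_lintegral_enorm _).trans (lintegral_mono_ae ?_)
  filter_upwards [ae_halfLine_pos] with t ht
  rw [enorm_smul, ← mul_assoc, ← ENNReal.ofReal_mul' (stieltjesKernel_pos hx ht).le,
    Real.enorm_eq_ofReal_abs]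
  gcongr
  exact hC x t hx ht

theorem memLp_kernelOp (hk : IsStieltjesBounded k) (hp : 1 < p) (hp_top : p ≠ ∞)
    (hu : MemLp u p halfLine) : MemLp (kernelOp k u) p halfLine := by
  have hp₀ : p ≠ 0 := (zero_lt_one.trans hp).ne'
  have hp' : 1 < p.toReal :=
    ENNReal.toReal_one ▸ (ENNReal.toReal_lt_toReal ENNReal.one_ne_top hp_top).2 hp
  obtain ⟨C, hC⟩ := hk.exists_enorm_kernelOp_le u
  refine ⟨(hk.aestronglyMeasurable hu.1).integral_prod_right',
    (eLpNorm_lt_top_iff_lintegral_rpow_enorm_lt_top hp₀ hp_top).2 ?_⟩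
  have hu_lt := lintegral_rpow_enorm_lt_top_of_eLpNorm_lt_top hp₀ hp_top hu.2
  have hilbert := lintegral_rpow_lintegral_stieltjesKernel_mul_le
    (Real.HolderConjugate.conjExponent hp') hu.1.enorm
  calc ∫⁻ x, ‖kernelOp k u x‖ₑ ^ p.toReal ∂halfLine
      ≤ ∫⁻ x, ENNReal.ofReal C ^ p.toReal *
          (∫⁻ t, ENNReal.ofReal (stieltjesKernel x t) * ‖u t‖ₑ ∂halfLine) ^ p.toReal ∂halfLine :=
        lintegral_mono_ae <| ae_halfLine_pos.mono fun x hx => by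
          rw [← ENNReal.mul_rpow_of_nonneg _ _ (by positivity)]
          gcongr
          exact hC x hx
    _ = ENNReal.ofReal C ^ p.toReal *
          ∫⁻ x, (∫⁻ t, ENNReal.ofReal (stieltjesKernel x t) * ‖u t‖ₑ ∂halfLine) ^ p.toReal
            ∂halfLine :=
        lintegral_const_mul' _ _ (by finiteness)
    _ < ∞ := ENNReal.mul_lt_top (by finiteness)
        (hilbert.trans_lt (ENNReal.mul_lt_top (by finiteness) hu_lt))

theorem memLp_secondKindOp (hk : IsStieltjesBounded k) (hp : 1 < p) (hp_top : p ≠ ∞)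
    (hu : MemLp u p halfLine) (c : ℝ) : MemLp (secondKindOp c k u) p halfLine :=
  hu.add ((hk.memLp_kernelOp hp hp_top hu).const_smul c)

theorem kernelOp_secondKindOp (hk : IsStieltjesBounded k) (hl : IsStieltjesBounded l)
    (hp : 1 < p) (hp_top : p ≠ ∞) (hu : MemLp u p halfLine) (c : ℝ) (hx : 0 < x) :
    kernelOp k (secondKindOp c l u) x = kernelOp k u x + c • kernelOp k (kernelOp l u) x := by
  have hlu := hl.memLp_kernelOp hp hp_top hu
  simp only [kernelOp.eq_def k, secondKindOp, smul_add, smul_comm _ c]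
  rw [integral_add (hk.integrable hp hp_top hu hx)
    ((hk.integrable hp hp_top hlu hx).fun_smul c), integral_smul]

theorem integrable_prod (hk : IsStieltjesBounded k) (hl : IsStieltjesBounded l) (hp : 1 < p)
    (hp_top : p ≠ ∞) (hu : MemLp u p halfLine) (hx : 0 < x) :
    Integrable (Function.uncurry fun y t => k x y • l y t • u t) (halfLine.prod halfLine) := by
  have hmeas : AEStronglyMeasurable (Function.uncurry fun y t => k x y • l y t • u t)
      (halfLine.prod halfLine) := AEStronglyMeasurable.smul
    hk.measurable.of_uncurry_left.aestronglyMeasurable.comp_fst (hl.aestronglyMeasurable hu.1)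
  refine (integrable_prod_iff hmeas).2 ⟨?_, ?_⟩
  · filter_upwards [ae_halfLine_pos] with y hy
    exact (hl.integrable hp hp_top hu hy).smul (k x y)
  · have h := hk.abs.integrable hp hp_top (hl.abs.memLp_kernelOp hp hp_top hu.norm) hx
    simpa only [Function.uncurry_apply_pair, norm_smul, Real.norm_eq_abs, integral_const_mul,
      kernelOp, smul_eq_mul] using h

theorem kernelOp_kernelOp [CompleteSpace E] (hk : IsStieltjesBounded k)
    (hl : IsStieltjesBounded l) (hp : 1 < p) (hp_top : p ≠ ∞) (hu : MemLp u p halfLine)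
    (hx : 0 < x) (hm : ∀ᵐ t ∂halfLine, ∫ y, k x y * l y t ∂halfLine = m x t) :
    kernelOp k (kernelOp l u) x = kernelOp m u x :=
  calc kernelOp k (kernelOp l u) x = ∫ y, ∫ t, k x y • l y t • u t ∂halfLine ∂halfLine := by
        simp only [kernelOp, integral_smul]
    _ = ∫ t, ∫ y, k x y • l y t • u t ∂halfLine ∂halfLine :=
        integral_integral_swap (hk.integrable_prod hl hp hp_top hu hx)
    _ = kernelOp m u x := integral_congr_ae <| hm.mono fun t ht => by
        simp only [smul_smul, integral_smul_const, ht]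

end IsStieltjesBounded

end Operators

section Kernels

open Real

variable {x t : ℝ}

/-- The kernel `P(x, t) = √(x t) / (x² + t²)`, the square root of `logKernel` under composition. -/
noncomputable def sqrtKernel (x t : ℝ) : ℝ := √(x * t) / (x ^ 2 + t ^ 2)

/-- The kernel `Q(x, t) = (x + t) / (x² + t²)`. The composition of `stieltjesKernel` and
`sqrtKernel` is a linear combination of `ratKernel` and `sqrtKernel`. -/
noncomputable def ratKernel (x t : ℝ) : ℝ := (x + t) / (x ^ 2 + t ^ 2)

theorem logKernel_comm (x t : ℝ) : logKernel x t = logKernel t x := by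
  rw [logKernel, logKernel, mul_comm x t, ← neg_sub (t ^ 2), ← neg_sub (log t), mul_neg,
    neg_div_neg_eq]

theorem sqrtKernel_comm (x t : ℝ) : sqrtKernel x t = sqrtKernel t x := by
  rw [sqrtKernel, sqrtKernel, mul_comm x, add_comm (x ^ 2)]

theorem ratKernel_comm (x t : ℝ) : ratKernel x t = ratKernel t x := by
  rw [ratKernel, ratKernel, add_comm x, add_comm (x ^ 2)]

/- With `√x / √t = exp s` this is `s ≤ sinh s`. -/
theorem sqrt_mul_mul_log_sub_log_le (ht : 0 < t) (hxt : t ≤ x) :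
    √(x * t) * (log x - log t) ≤ x - t := by
  have hx : 0 < x := ht.trans_le hxt
  have hratio : 1 ≤ √x / √t := (one_le_div (sqrt_pos.2 ht)).2 (sqrt_le_sqrt hxt)
  have hsinh : log (√x / √t) ≤ (√x / √t - (√x / √t)⁻¹) / 2 := by
    rw [← sinh_log (by positivity), self_le_sinh_iff]
    exact log_nonneg hratio
  have hlog : log (√x / √t) = (log x - log t) / 2 := by
    rw [log_div (by positivity) (by positivity), log_sqrt hx.le, log_sqrt ht.le, sub_div]
  have hdiff : √x / √t - (√x / √t)⁻¹ = (x - t) / √(x * t) := by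
    rw [sqrt_mul hx.le]
    field_simp
    rw [sq_sqrt hx.le, sq_sqrt ht.le]
  rw [hlog, hdiff, div_le_div_iff_of_pos_right two_pos, le_div_iff₀ (by positivity)] at hsinh
  rwa [mul_comm]

theorem abs_logKernel_le_of_lt (ht : 0 < t) (hxt : t < x) :
    |logKernel x t| ≤ stieltjesKernel x t := by
  have hx : 0 < x := ht.trans hxt
  have hden : 0 < (x + t) * (x - t) := mul_pos (by positivity) (sub_pos.2 hxt)
  have hlog : 0 ≤ log x - log t := sub_nonneg.2 (log_le_log ht hxt.le)
  rw [logKernel, sq_sub_sq, abs_of_nonneg (by positivity), stieltjesKernel,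
    div_le_div_iff₀ hden (by positivity), one_mul, mul_comm (x + t)]
  gcongr
  exact sqrt_mul_mul_log_sub_log_le ht hxt.le

theorem isStieltjesBounded_stieltjesKernel : IsStieltjesBounded stieltjesKernel :=
  ⟨measurable_stieltjesKernel, 1, fun x t hx ht => by
    rw [one_mul, abs_of_pos (stieltjesKernel_pos hx ht)]⟩

theorem isStieltjesBounded_logKernel : IsStieltjesBounded logKernel := by
  refine ⟨by unfold logKernel Function.uncurry; fun_prop, 1, fun x t hx ht => ?_⟩
  rw [one_mul]
  rcases lt_trichotomy x t with hxt | rfl | hxt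
  · rw [logKernel_comm, stieltjesKernel_comm]
    exact abs_logKernel_le_of_lt hx hxt
  · simpa [logKernel] using (stieltjesKernel_pos hx hx).le
  · exact abs_logKernel_le_of_lt ht hxt

theorem isStieltjesBounded_ratKernel : IsStieltjesBounded ratKernel := by
  refine ⟨by unfold ratKernel Function.uncurry; fun_prop, 2, fun x t hx ht => ?_⟩
  rw [ratKernel, stieltjesKernel, abs_of_pos (by positivity), mul_one_div,
    div_le_div_iff₀ (by positivity) (by positivity)]
  nlinarith [sq_nonneg (x - t)]

theorem isStieltjesBounded_sqrtKernel : IsStieltjesBounded sqrtKernel := by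
  refine ⟨by unfold sqrtKernel Function.uncurry; fun_prop, 1, fun x t hx ht => ?_⟩
  have hgm : 2 * √(x * t) ≤ x + t := by
    rw [sqrt_mul hx.le]
    nlinarith [sq_nonneg (√x - √t), sq_sqrt hx.le, sq_sqrt ht.le]
  rw [sqrtKernel, stieltjesKernel, abs_of_pos (by positivity), one_mul,
    div_le_div_iff₀ (by positivity) (by positivity)]
  nlinarith [sq_nonneg (x - t)]

theorem integral_sqrtKernel_mul_sqrtKernel (hx : 0 < x) (ht : 0 < t) (hxt : x ≠ t) :
    ∫ y, sqrtKernel x y * sqrtKernel y t ∂halfLine = logKernel x t := by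
  have hcongr : EqOn (fun y => sqrtKernel x y * sqrtKernel y t)
      (fun y => √(x * t) * (y / ((y ^ 2 + x ^ 2) * (y ^ 2 + t ^ 2)))) (Ioi 0) :=
    fun y (hy : 0 < y) => by
      simp only [sqrtKernel, sqrt_mul hx.le, sqrt_mul hy.le]
      field_simp
      rw [sq_sqrt hy.le]
      ring
  rw [halfLine, setIntegral_congr_fun measurableSet_Ioi hcongr, integral_const_mul,
    integral_div_sq_add_sq_mul_sq_add_sq_Ioi hx ht hxt, logKernel, mul_div_assoc]

theorem integral_stieltjesKernel_mul_sqrtKernel (hx : 0 < x) (ht : 0 < t) :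
    ∫ y, stieltjesKernel x y * sqrtKernel y t ∂halfLine =
      π / √2 * ratKernel x t - π * sqrtKernel x t := by
  have hpartial : EqOn (fun y => stieltjesKernel x y * sqrtKernel y t)
      (fun y => √t / (x ^ 2 + t ^ 2) * (x * (√y / (y ^ 2 + t ^ 2)) +
        t ^ 2 * (√y * (y ^ 2 + t ^ 2))⁻¹ - x * (√y * (y + x))⁻¹)) (Ioi 0) :=
    fun y (hy : 0 < y) => by
      simp only [stieltjesKernel, sqrtKernel, sqrt_mul hy.le]
      field_simp
      rw [sq_sqrt hy.le]
      ring
  have h₁ := (integrableOn_sqrt_div_sq_add_sq ht).const_mul x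
  have h₂ := (integrableOn_inv_sqrt_mul_sq_add_sq ht).const_mul (t ^ 2)
  have h₃ := (integrableOn_inv_sqrt_mul_add hx).const_mul x
  rw [halfLine, setIntegral_congr_fun measurableSet_Ioi hpartial, integral_const_mul,
    integral_sub (h₁.fun_add h₂) h₃, integral_add h₁ h₂]
  simp only [integral_const_mul]
  rw [integral_sqrt_div_sq_add_sq_Ioi ht,
    integral_inv_sqrt_mul_sq_add_sq_Ioi ht, integral_inv_sqrt_mul_add_Ioi hx, ratKernel, sqrtKernel,
    sqrt_mul hx.le]
  field_simp
  linear_combination √t * √2 * sq_sqrt hx.le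

theorem integral_ratKernel_mul_sqrtKernel (hx : 0 < x) (ht : 0 < t) (hxt : x ≠ t) :
    ∫ y, ratKernel x y * sqrtKernel y t ∂halfLine = π / √2 * stieltjesKernel x t := by
  have hxt' : x ^ 2 - t ^ 2 ≠ 0 := sub_ne_zero.2 fun h => hxt ((sq_eq_sq₀ hx.le ht.le).1 h)
  let g : ℝ → ℝ → ℝ := fun b y => x * (√y / (y ^ 2 + b ^ 2)) - b ^ 2 * (√y * (y ^ 2 + b ^ 2))⁻¹
  have hpartial : EqOn (fun y => ratKernel x y * sqrtKernel y t)
      (fun y => √t / (x ^ 2 - t ^ 2) * (g t y - g x y)) (Ioi 0) := fun y (hy : 0 < y) => by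
    simp only [g, ratKernel, sqrtKernel, sqrt_mul hy.le]
    field_simp
    rw [sq_sqrt hy.le]
    ring
  have h₁ : ∀ {b : ℝ}, 0 < b → IntegrableOn (fun y => x * (√y / (y ^ 2 + b ^ 2))) (Ioi 0) :=
    fun hb => (integrableOn_sqrt_div_sq_add_sq hb).const_mul x
  have h₂ : ∀ {b : ℝ}, 0 < b →
      IntegrableOn (fun y => b ^ 2 * (√y * (y ^ 2 + b ^ 2))⁻¹) (Ioi 0) :=
    fun {b} hb => (integrableOn_inv_sqrt_mul_sq_add_sq hb).const_mul (b ^ 2)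
  have hg_int : ∀ {b : ℝ}, 0 < b → IntegrableOn (g b) (Ioi 0) := fun hb => (h₁ hb).sub (h₂ hb)
  have hg : ∀ {b : ℝ}, 0 < b → ∫ y in Ioi 0, g b y = π / √2 * ((x - b) / √b) := fun {b} hb => by
    rw [integral_sub (h₁ hb) (h₂ hb), integral_const_mul, integral_const_mul,
      integral_sqrt_div_sq_add_sq_Ioi hb, integral_inv_sqrt_mul_sq_add_sq_Ioi hb]
    field_simp
  rw [halfLine, setIntegral_congr_fun measurableSet_Ioi hpartial, integral_const_mul,
    integral_sub (hg_int ht) (hg_int hx), hg ht, hg hx, stieltjesKernel]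
  field_simp
  ring

end Kernels

section Inversion

open Real
open scoped ENNReal

variable {E : Type*} [NormedAddCommGroup E] [NormedSpace ℝ E] [CompleteSpace E]
  {p : ℝ≥0∞} {u : ℝ → E} {x : ℝ}

theorem kernelOp_sqrtKernel_sqrtKernel (hp : 1 < p) (hp_top : p ≠ ∞) (hu : MemLp u p halfLine)
    (hx : 0 < x) : kernelOp sqrtKernel (kernelOp sqrtKernel u) x = kernelOp logKernel u x := by
  refine isStieltjesBounded_sqrtKernel.kernelOp_kernelOp isStieltjesBounded_sqrtKernel hp hp_top
    hu hx ?_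
  filter_upwards [ae_halfLine_pos, ae_halfLine_ne x] with t ht hxt
  exact integral_sqrtKernel_mul_sqrtKernel hx ht hxt

theorem kernelOp_ratKernel_sqrtKernel (hp : 1 < p) (hp_top : p ≠ ∞) (hu : MemLp u p halfLine)
    (hx : 0 < x) :
    kernelOp ratKernel (kernelOp sqrtKernel u) x = (π / √2) • kernelOp stieltjesKernel u x := by
  rw [isStieltjesBounded_ratKernel.kernelOp_kernelOp isStieltjesBounded_sqrtKernel hp hp_top hu hx
    (m := fun x t => π / √2 * stieltjesKernel x t)]
  · simp only [kernelOp, mul_smul, integral_smul]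
  · filter_upwards [ae_halfLine_pos, ae_halfLine_ne x] with t ht hxt
    exact integral_ratKernel_mul_sqrtKernel hx ht hxt

theorem kernelOp_stieltjesKernel_sqrtKernel (hp : 1 < p) (hp_top : p ≠ ∞)
    (hu : MemLp u p halfLine) (hx : 0 < x) :
    kernelOp stieltjesKernel (kernelOp sqrtKernel u) x =
      (π / √2) • kernelOp ratKernel u x - π • kernelOp sqrtKernel u x := by
  rw [isStieltjesBounded_stieltjesKernel.kernelOp_kernelOp isStieltjesBounded_sqrtKernel hp hp_top
    hu hx (m := fun x t => π / √2 * ratKernel x t - π * sqrtKernel x t)]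
  · simp only [kernelOp, sub_smul, mul_smul]
    rw [integral_sub ((isStieltjesBounded_ratKernel.integrable hp hp_top hu hx).fun_smul _)
      ((isStieltjesBounded_sqrtKernel.integrable hp hp_top hu hx).fun_smul _), integral_smul,
      integral_smul]
  · filter_upwards [ae_halfLine_pos] with t ht
    exact integral_stieltjesKernel_mul_sqrtKernel hx ht

theorem kernelOp_sqrtKernel_stieltjesKernel_comm (hp : 1 < p) (hp_top : p ≠ ∞)
    (hu : MemLp u p halfLine) (hx : 0 < x) :
    kernelOp sqrtKernel (kernelOp stieltjesKernel u) x =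
      kernelOp stieltjesKernel (kernelOp sqrtKernel u) x := by
  have hP := isStieltjesBounded_sqrtKernel
  have hS := isStieltjesBounded_stieltjesKernel
  let m : ℝ → ℝ → ℝ := fun x t => ∫ y, stieltjesKernel x y * sqrtKernel y t ∂halfLine
  have hcomm : ∀ᵐ t ∂halfLine, ∫ y, sqrtKernel x y * stieltjesKernel y t ∂halfLine = m x t :=
    ae_halfLine_pos.mono fun t ht => by
      simp_rw [m, mul_comm (sqrtKernel x _), stieltjesKernel_comm _ t, sqrtKernel_comm x]
      rw [integral_stieltjesKernel_mul_sqrtKernel hx ht,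
        integral_stieltjesKernel_mul_sqrtKernel ht hx, ratKernel_comm, sqrtKernel_comm]
  rw [hP.kernelOp_kernelOp hS hp hp_top hu hx hcomm,
    hS.kernelOp_kernelOp hP hp hp_top hu hx (m := m) (.of_forall fun _ => rfl)]

theorem kernelOp_stieltjesKernel_logKernel (hp : 1 < p) (hp_top : p ≠ ∞)
    (hu : MemLp u p halfLine) (hx : 0 < x) :
    kernelOp stieltjesKernel (kernelOp logKernel u) x =
      (π ^ 2 / 2) • kernelOp stieltjesKernel u x - π • kernelOp logKernel u x := by
  have hPu := isStieltjesBounded_sqrtKernel.memLp_kernelOp hp hp_top hu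
  have hLu : kernelOp logKernel u =ᵐ[halfLine] kernelOp sqrtKernel (kernelOp sqrtKernel u) :=
    ae_halfLine_pos.mono fun y hy => (kernelOp_sqrtKernel_sqrtKernel hp hp_top hu hy).symm
  rw [kernelOp_congr_ae hLu, kernelOp_stieltjesKernel_sqrtKernel hp hp_top hPu hx,
    kernelOp_ratKernel_sqrtKernel hp hp_top hu hx, kernelOp_sqrtKernel_sqrtKernel hp hp_top hu hx,
    smul_smul, div_mul_div_comm, mul_self_sqrt two_pos.le, sq]

theorem kernelOp_logKernel_stieltjesKernel_comm (hp : 1 < p) (hp_top : p ≠ ∞)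
    (hu : MemLp u p halfLine) (hx : 0 < x) :
    kernelOp logKernel (kernelOp stieltjesKernel u) x =
      kernelOp stieltjesKernel (kernelOp logKernel u) x := by
  have hPu := isStieltjesBounded_sqrtKernel.memLp_kernelOp hp hp_top hu
  have hSu := isStieltjesBounded_stieltjesKernel.memLp_kernelOp hp hp_top hu
  have hPS : kernelOp sqrtKernel (kernelOp stieltjesKernel u) =ᵐ[halfLine]
      kernelOp stieltjesKernel (kernelOp sqrtKernel u) :=
    ae_halfLine_pos.mono fun y hy => kernelOp_sqrtKernel_stieltjesKernel_comm hp hp_top hu hy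
  have hPP : kernelOp sqrtKernel (kernelOp sqrtKernel u) =ᵐ[halfLine] kernelOp logKernel u :=
    ae_halfLine_pos.mono fun y hy => kernelOp_sqrtKernel_sqrtKernel hp hp_top hu hy
  rw [← kernelOp_sqrtKernel_sqrtKernel hp hp_top hSu hx, kernelOp_congr_ae hPS,
    kernelOp_sqrtKernel_stieltjesKernel_comm hp hp_top hPu hx, kernelOp_congr_ae hPP]

theorem secondKindOp_stieltjesKernel_logKernel (hp : 1 < p) (hp_top : p ≠ ∞)
    (hu : MemLp u p halfLine) (hx : 0 < x) :
    secondKindOp (1 / π) stieltjesKernel (secondKindOp (-(2 / π ^ 2)) logKernel u) x = u x := by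
  rw [secondKindOp, isStieltjesBounded_stieltjesKernel.kernelOp_secondKindOp
    isStieltjesBounded_logKernel hp hp_top hu _ hx, secondKindOp,
    kernelOp_stieltjesKernel_logKernel hp hp_top hu hx]
  match_scalars <;> field_simp <;> ring

theorem secondKindOp_logKernel_stieltjesKernel (hp : 1 < p) (hp_top : p ≠ ∞)
    (hu : MemLp u p halfLine) (hx : 0 < x) :
    secondKindOp (-(2 / π ^ 2)) logKernel (secondKindOp (1 / π) stieltjesKernel u) x = u x := by
  rw [secondKindOp, isStieltjesBounded_logKernel.kernelOp_secondKindOp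
    isStieltjesBounded_stieltjesKernel hp hp_top hu _ hx, secondKindOp,
    kernelOp_logKernel_stieltjesKernel_comm hp hp_top hu hx,
    kernelOp_stieltjesKernel_logKernel hp hp_top hu hx]
  match_scalars <;> field_simp <;> ring

theorem corollary1_general (hp : 1 < p) (hp_top : p ≠ ∞) :
    (∀ u : ℝ → E, MemLp u p halfLine → ∀ x : ℝ, 0 < x →
      Integrable (fun t => stieltjesKernel x t • u t) halfLine ∧
      Integrable (fun t => logKernel x t • u t) halfLine) ∧
    (∀ g : ℝ → E, MemLp g p halfLine →
      MemLp (secondKindOp (-(2 / π ^ 2)) logKernel g) p halfLine ∧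
      (∀ x : ℝ, 0 < x →
        secondKindOp (1 / π) stieltjesKernel (secondKindOp (-(2 / π ^ 2)) logKernel g) x = g x) ∧
      (∀ f : ℝ → E, MemLp f p halfLine →
        (∀ᵐ x ∂halfLine, secondKindOp (1 / π) stieltjesKernel f x = g x) →
          f =ᵐ[halfLine] secondKindOp (-(2 / π ^ 2)) logKernel g)) ∧
    (∀ f : ℝ → E, MemLp f p halfLine →
      MemLp (secondKindOp (1 / π) stieltjesKernel f) p halfLine ∧
      (∀ x : ℝ, 0 < x →
        f x = secondKindOp (-(2 / π ^ 2)) logKernel (secondKindOp (1 / π) stieltjesKernel f) x) ∧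
      (∀ g : ℝ → E, MemLp g p halfLine →
        (∀ᵐ x ∂halfLine, f x = secondKindOp (-(2 / π ^ 2)) logKernel g x) →
          g =ᵐ[halfLine] secondKindOp (1 / π) stieltjesKernel f)) := by
  have hS := isStieltjesBounded_stieltjesKernel
  have hL := isStieltjesBounded_logKernel
  refine ⟨fun u hu x hx => ⟨hS.integrable hp hp_top hu hx, hL.integrable hp hp_top hu hx⟩,
    fun g hg => ⟨hL.memLp_secondKindOp hp hp_top hg _,
      fun x hx => secondKindOp_stieltjesKernel_logKernel hp hp_top hg hx, fun f hf hfg => ?_⟩,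
    fun f hf => ⟨hS.memLp_secondKindOp hp hp_top hf _,
      fun x hx => (secondKindOp_logKernel_stieltjesKernel hp hp_top hf hx).symm,
      fun g hg hfg => ?_⟩⟩
  · filter_upwards [ae_halfLine_pos, secondKindOp_congr_ae (-(2 / π ^ 2)) logKernel hfg] with x hx h
    rw [← h, secondKindOp_logKernel_stieltjesKernel hp hp_top hf hx]
  · filter_upwards [ae_halfLine_pos, secondKindOp_congr_ae (1 / π) stieltjesKernel hfg] with x hx h
    rw [h, secondKindOp_stieltjesKernel_logKernel hp hp_top hg hx]

end Inversion

theorem logSide_eq_secondKindOp {𝕜 : Type*} [RCLike 𝕜] (g : ℝ → 𝕜) :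
    logSide g = secondKindOp (-(2 / Real.pi ^ 2)) logKernel g :=
  funext fun x => by rw [logSide, secondKindOp, neg_smul, sub_eq_add_neg]; rfl

theorem corollary1 {𝕜 : Type*} [RCLike 𝕜] :
    -- both integrals converge absolutely, for every square-integrable function and every `x > 0`
    (∀ u : ℝ → 𝕜, MemLp u 2 halfLine → ∀ x : ℝ, 0 < x →
      Integrable (fun t => stieltjesKernel x t • u t) halfLine ∧
      Integrable (fun t => logKernel x t • u t) halfLine) ∧
    -- for given `g`, the function `logSide g` is in `L₂`, solves the equation at every `x > 0`,
    -- and is the only solution in `L₂`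
    (∀ g : ℝ → 𝕜, MemLp g 2 halfLine →
      MemLp (logSide g) 2 halfLine ∧
      (∀ x : ℝ, 0 < x → stieltjesSide (logSide g) x = g x) ∧
      (∀ f : ℝ → 𝕜, MemLp f 2 halfLine →
        (∀ᵐ x ∂halfLine, stieltjesSide f x = g x) → f =ᵐ[halfLine] logSide g)) ∧
    -- for given `f`, the function `stieltjesSide f` is in `L₂`, solves the second equation at
    -- every `x > 0`, and is the only solution in `L₂`
    (∀ f : ℝ → 𝕜, MemLp f 2 halfLine →
      MemLp (stieltjesSide f) 2 halfLine ∧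
      (∀ x : ℝ, 0 < x → f x = logSide (stieltjesSide f) x) ∧
      (∀ g : ℝ → 𝕜, MemLp g 2 halfLine →
        (∀ᵐ x ∂halfLine, f x = logSide g x) → g =ᵐ[halfLine] stieltjesSide f)) := by
  simp only [logSide_eq_secondKindOp]
  exact corollary1_general ENNReal.one_lt_two ENNReal.ofNat_ne_top
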